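/- Let $\Phi$ be a finite reduced crystallographic root system (the root system of a connected, simply connected, complex semisimple Lie group $G$), with simple roots $\{\alpha_i\}_{i\in I}$, simple coroots $\{\alpha_i^\vee\}_{i\in I}$ and weight lattice $P$. For a dominant weight $\lambda\in P^+$ let $\mathcal B(\lambda)$ be the highest weight crystal of highest weight $\lambda$, with raising and lowering operators $e_i,f_i:\mathcal B(\lambda)\to\mathcal B(\lambda)\sqcup\{0\}$ $(i\in I)$; up to isomorphism, $\mathcal B(\lambda)$ is the set of all paths obtained from the straight path from $0$ to $\lambda$ by Littelmann's root operators $e_i,f_i$. For $i\in I$, the $i$-strings of $\mathcal B(\lambda)$ are the classes of the equivalence relation in which $x\sim_i y$ if and only if $x=e_i^k(y)$ or $y=e_i^k(x)$ for some $k\ge 0$; the highest weight element $u_S$ of an $i$-string $S$ is its unique element with $e_i(u_S)=0$. A subset $X\subseteq\mathcal B(\lambda)$ is called extremal if $S\cap X\in\{\emptyset,\{u_S\},S\}$ for every $i\in I$ and every $i$-string $S$ of $\mathcal B(\lambda)$. An element $x\in X$ is called a lowest weight element of $X$ if for each $i\in I$ either $f_i(x)=0$ or $f_i(x)\notin X$.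 For $Z\subseteq\mathcal B(\lambda)$ put $$\mathcal E(Z)=\{e_{i_k}^{d_k}\cdots e_{i_1}^{d_1}(z) : z\in Z,\ k\ge 0,\ i_j\in I,\ d_j\ge 0\}\setminus\{0\}.$$ Proposition. Let $X\subseteq\mathcal B(\lambda)$ be an extremal subset and let $Z$ be the set of all lowest weight elements of $X$. Then $X=\mathcal E(Z)$. -/

import Mathlib

/-! ### Normal crystals over a root system -/

namespace CrystalTheory

/-- The `k`-th power of a partial map `g : B → B ⊔ {0}`, where `none` plays the role of `0`. -/
def partialPow {B : Type*} (g : B → Option B) : ℕ → B → Option B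
  | 0, x => some x
  | k + 1, x => (partialPow g k x).bind g

/-- The weight lattice of a root system: the vectors pairing integrally with every coroot. -/
def weightLattice {ι M N : Type*} [AddCommGroup M] [Module ℝ M] [AddCommGroup N] [Module ℝ N]
    (P : RootPairing ι ℝ M N) : AddSubgroup M where
  carrier := {x | ∀ j, ∃ n : ℤ, P.coroot' j x = n}
  zero_mem' := fun j => ⟨0, by simp⟩
  add_mem' := by
    intro x y hx hy j
    obtain ⟨n, hn⟩ := hx j
    obtain ⟨k, hk⟩ := hy j
    exact ⟨n + k, by rw [map_add, hn, hk]; push_cast; rfl⟩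
  neg_mem' := by
    intro x hx j
    obtain ⟨n, hn⟩ := hx j
    exact ⟨-n, by rw [map_neg, hn]; push_cast; rfl⟩

section

variable {ι M N : Type*} [AddCommGroup M] [Module ℝ M] [AddCommGroup N] [Module ℝ N]
  {P : RootPairing ι ℝ M N}

/-- A vector is dominant if it pairs nonnegatively with every simple coroot. -/
def IsDominant (b : P.Base) (x : M) : Prop :=
  ∀ i : b.support, 0 ≤ P.coroot' i x

/-- A (normal) crystal for a root system with a chosen base. The index set of the Dynkin diagram
is `b.support`; `none` plays the role of the extra element `0`. -/
structure Crystal (b : P.Base) where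
  /-- the underlying set -/
  carrier : Type*
  /-- the weight map -/
  wt : carrier → weightLattice P
  /-- the raising operators -/
  e : b.support → carrier → Option carrier
  /-- the lowering operators -/
  f : b.support → carrier → Option carrier
  /-- the length of the `i`-string above an element -/
  ε : b.support → carrier → ℕ
  /-- the length of the `i`-string below an element -/
  φ : b.support → carrier → ℕ
  f_eq_some_iff : ∀ i x y, f i x = some y ↔ e i y = some x
  wt_of_f : ∀ i x y, f i x = some y → (wt y : M) = wt x - P.root i
  isGreatest_ε : ∀ i x, IsGreatest {k : ℕ | partialPow (e i) k x ≠ none} (ε i x)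
  isGreatest_φ : ∀ i x, IsGreatest {k : ℕ | partialPow (f i) k x ≠ none} (φ i x)
  φ_eq : ∀ i x, (φ i x : ℝ) = P.coroot' i (wt x : M) + ε i x

namespace Crystal

variable {b : P.Base}

/-- An isomorphism of crystals: a bijection compatible with weights, raising and lowering
operators (and hence with the string lengths). -/
structure Iso (C : Crystal b) (D : Crystal b) where
  /-- the underlying bijection -/
  toEquiv : C.carrier ≃ D.carrier
  wt_apply : ∀ x, D.wt (toEquiv x) = C.wt x
  e_apply : ∀ i x, D.e i (toEquiv x) = (C.e i x).map toEquiv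
  f_apply : ∀ i x, D.f i (toEquiv x) = (C.f i x).map toEquiv

variable (C : Crystal b)

/-- The relation `x ∼ᵢ y`: one of the two elements is obtained from the other by a power of the
raising operator `e i`. -/
def SameString (i : b.support) (x y : C.carrier) : Prop :=
  (∃ k, partialPow (C.e i) k y = some x) ∨ (∃ k, partialPow (C.e i) k x = some y)

/-- The `i`-string through `x`. -/
def string (i : b.support) (x : C.carrier) : Set C.carrier :=
  {y | C.SameString i y x}

/-- `u` is the highest weight element `u_S` of the `i`-string `S`. -/
def IsStringTop (i : b.support) (S : Set C.carrier) (u : C.carrier) : Prop :=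
  u ∈ S ∧ C.e i u = none

/-- `X` is extremal if it meets every `i`-string `S` in `∅`, in `{u_S}`, or in all of `S`. -/
def IsExtremal (X : Set C.carrier) : Prop :=
  ∀ (i : b.support) (x : C.carrier),
    C.string i x ∩ X = ∅ ∨
    (∃ u, C.IsStringTop i (C.string i x) u ∧ C.string i x ∩ X = {u}) ∨
    C.string i x ∩ X = C.string i x

/-- The lowest weight elements of `X`: those `x ∈ X` such that, for every `i`, either `f i x` is
`0` or it does not lie in `X`. -/
def lowestWeightElements (X : Set C.carrier) : Set C.carrier :=
  {x | x ∈ X ∧ ∀ i, C.f i x = none ∨ ∃ y, C.f i x = some y ∧ y ∉ X}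

/-- For a word `[(i₁, d₁), …, (i_k, d_k)]`, the partial map `e_{i_k}^{d_k} ⋯ e_{i₁}^{d₁}`. -/
def raise : List (b.support × ℕ) → C.carrier → Option C.carrier
  | [], x => some x
  | (i, d) :: w, x => (partialPow (C.e i) d x).bind (raise w)

/-- `ℰ(Z)`: all nonzero elements `e_{i_k}^{d_k} ⋯ e_{i₁}^{d₁} (z)` with `z ∈ Z`. -/
def raisingClosure (Z : Set C.carrier) : Set C.carrier :=
  {y | ∃ z ∈ Z, ∃ w : List (b.support × ℕ), C.raise w z = some y}

end Crystal

end

/-! ### The root operators on real-valued functions on the unit interval -/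

section Shift

/-- The minimum of `h`. -/
noncomputable def minValue (h : unitInterval → ℝ) : ℝ := ⨅ s, h s

/-- The minimum of `h` on `[t, 1]`. -/
noncomputable def futureMin (h : unitInterval → ℝ) (t : unitInterval) : ℝ :=
  ⨅ s : Set.Ici t, h s

/-- The minimum of `h` on `[0, t]`. -/
noncomputable def pastMin (h : unitInterval → ℝ) (t : unitInterval) : ℝ :=
  ⨅ s : Set.Iic t, h s

/-- The multiple of the simple root subtracted at time `t` by the lowering operator. -/
noncomputable def lowerShift (h : unitInterval → ℝ) (t : unitInterval) : ℝ :=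
  min 1 (futureMin h t - minValue h)

/-- The multiple of the simple root added at time `t` by the raising operator. -/
noncomputable def raiseShift (h : unitInterval → ℝ) (t : unitInterval) : ℝ :=
  max 0 (1 + minValue h - pastMin h t)

theorem bddBelow_of_continuous {h : unitInterval → ℝ} (hc : Continuous h) :
    BddBelow (Set.range h) :=
  (isCompact_range hc).bddBelow

theorem minValue_le {h : unitInterval → ℝ} (hc : Continuous h) (t : unitInterval) :
    minValue h ≤ h t :=
  ciInf_le (bddBelow_of_continuous hc) t

theorem exists_eq_minValue {h : unitInterval → ℝ} (hc : Continuous h) :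
    ∃ p, h p = minValue h := by
  obtain ⟨p, hp⟩ := (isCompact_range hc).sInf_mem (Set.range_nonempty h)
  exact ⟨p, hp⟩

theorem futureMin_le {h : unitInterval → ℝ} (hc : Continuous h) {t s : unitInterval}
    (hs : t ≤ s) : futureMin h t ≤ h s :=
  ciInf_le (f := fun s : Set.Ici t => h s)
    ((bddBelow_of_continuous hc).mono (by rintro _ ⟨x, rfl⟩; exact ⟨x, rfl⟩)) ⟨s, hs⟩

theorem le_futureMin {h : unitInterval → ℝ} {t : unitInterval} {c : ℝ}
    (H : ∀ s, t ≤ s → c ≤ h s) : c ≤ futureMin h t :=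
  haveI : Nonempty (Set.Ici t) := ⟨⟨t, le_refl t⟩⟩
  le_ciInf fun s => H s s.2

theorem pastMin_le {h : unitInterval → ℝ} (hc : Continuous h) {t s : unitInterval}
    (hs : s ≤ t) : pastMin h t ≤ h s :=
  ciInf_le (f := fun s : Set.Iic t => h s)
    ((bddBelow_of_continuous hc).mono (by rintro _ ⟨x, rfl⟩; exact ⟨x, rfl⟩)) ⟨s, hs⟩

theorem le_pastMin {h : unitInterval → ℝ} {t : unitInterval} {c : ℝ}
    (H : ∀ s, s ≤ t → c ≤ h s) : c ≤ pastMin h t :=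
  haveI : Nonempty (Set.Iic t) := ⟨⟨t, le_refl t⟩⟩
  le_ciInf fun s => H s s.2

theorem continuous_futureMin {h : unitInterval → ℝ} (hc : Continuous h) :
    Continuous (futureMin h) := by
  have key : futureMin h = fun t => sInf ((fun s => h (max t s)) '' Set.univ) := by
    funext t
    rw [futureMin, iInf]
    congr 1
    ext y
    constructor
    · rintro ⟨⟨s, hs⟩, rfl⟩
      exact ⟨s, trivial, by simp [max_eq_right (show t ≤ s from hs)]⟩
    · rintro ⟨s, -, rfl⟩
      exact ⟨⟨max t s, le_max_left t s⟩, rfl⟩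
  rw [key]
  exact isCompact_univ.continuous_sInf (f := fun t s => h (max t s))
    (hc.comp (continuous_fst.max continuous_snd))

theorem continuous_pastMin {h : unitInterval → ℝ} (hc : Continuous h) :
    Continuous (pastMin h) := by
  have key : pastMin h = fun t => sInf ((fun s => h (min t s)) '' Set.univ) := by
    funext t
    rw [pastMin, iInf]
    congr 1
    ext y
    constructor
    · rintro ⟨⟨s, hs⟩, rfl⟩
      exact ⟨s, trivial, by simp [min_eq_right (show s ≤ t from hs)]⟩
    · rintro ⟨s, -, rfl⟩
      exact ⟨⟨min t s, min_le_left t s⟩, rfl⟩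
  rw [key]
  exact isCompact_univ.continuous_sInf (f := fun t s => h (min t s))
    (hc.comp (continuous_fst.min continuous_snd))

theorem continuous_lowerShift {h : unitInterval → ℝ} (hc : Continuous h) :
    Continuous (lowerShift h) :=
  continuous_const.min ((continuous_futureMin hc).sub continuous_const)

theorem continuous_raiseShift {h : unitInterval → ℝ} (hc : Continuous h) :
    Continuous (raiseShift h) :=
  continuous_const.max (continuous_const.sub (continuous_pastMin hc))

theorem minValue_le_futureMin {h : unitInterval → ℝ} (hc : Continuous h) (t : unitInterval) :
    minValue h ≤ futureMin h t := le_futureMin fun s _ => minValue_le hc s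

theorem minValue_le_pastMin {h : unitInterval → ℝ} (hc : Continuous h) (t : unitInterval) :
    minValue h ≤ pastMin h t := le_pastMin fun s _ => minValue_le hc s

theorem futureMin_mono {h : unitInterval → ℝ} (hc : Continuous h) {s t : unitInterval}
    (hst : s ≤ t) : futureMin h s ≤ futureMin h t :=
  le_futureMin fun _ hr => futureMin_le hc (hst.trans hr)

theorem lowerShift_one {h : unitInterval → ℝ}
    (h1 : 1 ≤ h 1 - minValue h) : lowerShift h 1 = 1 := by
  have : h 1 ≤ futureMin h 1 := le_futureMin fun s hs => by
    rw [le_antisymm hs (unitInterval.le_one s)]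
  exact min_eq_left (h1.trans (by linarith))

theorem lowerShift_zero {h : unitInterval → ℝ} (hc : Continuous h) : lowerShift h 0 = 0 := by
  obtain ⟨p, hp⟩ := exists_eq_minValue hc
  have h1 : futureMin h 0 ≤ h p := futureMin_le hc (unitInterval.nonneg p)
  have h2 := minValue_le_futureMin hc 0
  have h3 : futureMin h 0 - minValue h = 0 := by linarith
  rw [lowerShift, h3]
  norm_num

theorem raiseShift_one {h : unitInterval → ℝ} (hc : Continuous h) : raiseShift h 1 = 1 := by
  obtain ⟨p, hp⟩ := exists_eq_minValue hc
  have h1 : pastMin h 1 ≤ h p := pastMin_le hc (unitInterval.le_one p)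
  have h2 := minValue_le_pastMin hc 1
  have h3 : 1 + minValue h - pastMin h 1 = 1 := by linarith
  rw [raiseShift, h3]
  norm_num

theorem raiseShift_zero {h : unitInterval → ℝ} (hm : 1 ≤ h 0 - minValue h) :
    raiseShift h 0 = 0 := by
  have h1 : h 0 ≤ pastMin h 0 := le_pastMin fun s hs => by
    rw [le_antisymm hs (unitInterval.nonneg s)]
  exact max_eq_left (by linarith)

theorem lower_bound {h : unitInterval → ℝ} (hc : Continuous h) {s t : unitInterval}
    (hst : s ≤ t) :
    minValue h - lowerShift h t ≤ h s - 2 * lowerShift h s := by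
  have h1 := futureMin_mono hc hst
  have h2 := futureMin_le hc (le_refl s)
  have h3 := minValue_le_futureMin hc s
  simp only [lowerShift]
  rcases min_cases 1 (futureMin h s - minValue h) with ⟨a, a'⟩ | ⟨a, a'⟩ <;>
  rcases min_cases 1 (futureMin h t - minValue h) with ⟨c, c'⟩ | ⟨c, c'⟩ <;>
  rw [a, c] <;> linarith

theorem exists_lower {h : unitInterval → ℝ} (hc : Continuous h) {t : unitInterval}
    (ht : minValue h < futureMin h t) :
    ∃ s ≤ t, h s - 2 * lowerShift h s = minValue h - lowerShift h t := by
  set m := minValue h with hm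
  set c := min (m + 1) (futureMin h t) with hcdef
  have hmc : m < c := lt_min (by linarith) ht
  have hct : c ≤ futureMin h t := min_le_right _ _
  have hc1 : c ≤ m + 1 := min_le_left _ _
  obtain ⟨p, hp⟩ := exists_eq_minValue hc
  have hpt : p ≤ t := by
    by_contra hcon
    have := futureMin_le hc (not_le.mp hcon).le
    linarith
  have hK : IsCompact {s | s ≤ t ∧ h s ≤ c} :=
    ((isClosed_le continuous_id continuous_const).inter
      (isClosed_le hc continuous_const)).isCompact
  obtain ⟨s, ⟨hst, hsc⟩, hmax⟩ := hK.exists_isGreatest ⟨p, hpt, by linarith⟩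
  have hsc' : h s = c := by
    refine le_antisymm hsc ?_
    have h1 : c ∈ Set.Icc (h s) (h t) := ⟨hsc, hct.trans (futureMin_le hc le_rfl)⟩
    obtain ⟨r, hr, hrc⟩ := intermediate_value_Icc hst hc.continuousOn h1
    have : r ≤ s := hmax ⟨hr.2, hrc.le⟩
    rw [le_antisymm hr.1 this, hrc]
  have hJ : futureMin h s = c := by
    refine le_antisymm (hsc' ▸ futureMin_le hc le_rfl) (le_futureMin fun r hr => ?_)
    rcases le_total t r with h1 | h1
    · exact hct.trans (futureMin_le hc h1)
    · by_contra hcon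
      have h2 : r ≤ s := hmax ⟨h1, (not_le.mp hcon).le⟩
      rw [le_antisymm h2 hr] at hcon
      exact hcon hsc'.ge
  have e1 : lowerShift h s = c - m := by
    rw [lowerShift, hJ, ← hm]
    exact min_eq_right (by linarith)
  have e2 : lowerShift h t = c - m := by
    rw [lowerShift, ← hm, hcdef, ← min_sub_sub_right]
    congr 1
    ring
  exact ⟨s, hst, by rw [e1, e2, hsc']; ring⟩

theorem minValue_lower {h : unitInterval → ℝ} (hc : Continuous h)
    (h1 : 1 ≤ h 1 - minValue h) :
    minValue (fun t => h t - 2 * lowerShift h t) = minValue h - 1 := by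
  have hc' : Continuous (fun t => h t - 2 * lowerShift h t) :=
    hc.sub (continuous_const.mul (continuous_lowerShift hc))
  have hL := lowerShift_one h1
  apply le_antisymm
  · have : minValue h < futureMin h 1 := by
      have : h 1 ≤ futureMin h 1 := le_futureMin fun s hs => by
        rw [le_antisymm hs (unitInterval.le_one s)]
      linarith
    obtain ⟨s, -, hs⟩ := exists_lower hc this
    rw [hL] at hs
    rw [← hs]
    exact minValue_le hc' s
  · refine le_ciInf fun s => ?_
    have := lower_bound hc (show s ≤ 1 from unitInterval.le_one s)
    rwa [hL] at this

theorem raiseShift_lower {h : unitInterval → ℝ} (hc : Continuous h)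
    (h1 : 1 ≤ h 1 - minValue h) (t : unitInterval) :
    raiseShift (fun t => h t - 2 * lowerShift h t) t = lowerShift h t := by
  have hc' : Continuous (fun t => h t - 2 * lowerShift h t) :=
    hc.sub (continuous_const.mul (continuous_lowerShift hc))
  have hlow : minValue h - lowerShift h t ≤ pastMin (fun t => h t - 2 * lowerShift h t) t :=
    le_pastMin fun s hs => lower_bound hc hs
  have hpos : 0 ≤ lowerShift h t :=
    le_min zero_le_one (by linarith [minValue_le_futureMin hc t])
  rw [raiseShift, minValue_lower hc h1]
  rcases (minValue_le_futureMin hc t).eq_or_lt with heq | hlt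
  · have h0 : lowerShift h t = 0 := by rw [lowerShift, ← heq]; norm_num
    rw [h0] at hlow ⊢
    exact max_eq_left (by linarith)
  · obtain ⟨s, hs, hs'⟩ := exists_lower hc hlt
    have h2 := pastMin_le hc' hs
    rw [hs'] at h2
    have h3 := le_antisymm h2 hlow
    rw [h3]
    rw [max_eq_right] <;> linarith

/-- Time reversal. -/
def reversed (h : unitInterval → ℝ) (t : unitInterval) : ℝ := h (unitInterval.symm t)

theorem minValue_reversed (h : unitInterval → ℝ) : minValue (reversed h) = minValue h :=
  unitInterval.symm_bijective.surjective.iInf_comp h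

theorem futureMin_reversed (h : unitInterval → ℝ) (t : unitInterval) :
    futureMin (reversed h) t = pastMin h (unitInterval.symm t) := by
  rw [futureMin, pastMin, iInf, iInf]
  congr 1
  ext y
  constructor
  · rintro ⟨⟨s, hs⟩, rfl⟩
    exact ⟨⟨unitInterval.symm s, unitInterval.symm_le_symm.mpr hs⟩, rfl⟩
  · rintro ⟨⟨s, hs⟩, rfl⟩
    refine ⟨⟨unitInterval.symm s, ?_⟩, by simp [reversed]⟩
    have := unitInterval.symm_le_symm.mpr (show s ≤ unitInterval.symm t from hs)
    simpa using this

theorem pastMin_reversed (h : unitInterval → ℝ) (t : unitInterval) :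
    pastMin (reversed h) t = futureMin h (unitInterval.symm t) := by
  have := futureMin_reversed (reversed h) (unitInterval.symm t)
  rw [unitInterval.symm_symm] at this
  rw [← this]
  congr 1
  funext s
  simp [reversed]

theorem lowerShift_reversed (h : unitInterval → ℝ) (t : unitInterval) :
    lowerShift (reversed h) t = 1 - raiseShift h (unitInterval.symm t) := by
  rw [lowerShift, raiseShift, futureMin_reversed, minValue_reversed]
  rcases min_cases 1 (pastMin h (unitInterval.symm t) - minValue h) with ⟨a, a'⟩ | ⟨a, a'⟩
  · rw [a, max_eq_left (by linarith)]; ring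
  · rw [a, max_eq_right (by linarith)]; ring

theorem minValue_add_const {h : unitInterval → ℝ} (hc : Continuous h) (c : ℝ) :
    minValue (fun t => h t + c) = minValue h + c := by
  apply le_antisymm
  · obtain ⟨p, hp⟩ := exists_eq_minValue hc
    rw [← hp]
    exact minValue_le (hc.add continuous_const) p
  · exact le_ciInf fun s => by linarith [minValue_le hc s]

theorem pastMin_add_const {h : unitInterval → ℝ} (hc : Continuous h) (c : ℝ)
    (t : unitInterval) : pastMin (fun t => h t + c) t = pastMin h t + c := by
  apply le_antisymm
  · have : pastMin (fun t => h t + c) t - c ≤ pastMin h t := le_pastMin fun s hs => by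
      have h2 : pastMin (fun t => h t + c) t ≤ h s + c :=
        pastMin_le (hc.add continuous_const) hs
      linarith
    linarith
  · exact le_pastMin fun s hs => by linarith [pastMin_le hc hs]

theorem raise_eq_reversed (h : unitInterval → ℝ) :
    (fun t => h t + 2 * raiseShift h t) =
      reversed (fun t => (reversed h t - 2 * lowerShift (reversed h) t) + 2) := by
  funext t
  have := lowerShift_reversed h (unitInterval.symm t)
  rw [unitInterval.symm_symm] at this
  simp only [reversed, unitInterval.symm_symm] at this ⊢
  rw [this]
  ring

theorem continuous_reversed {h : unitInterval → ℝ} (hc : Continuous h) :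
    Continuous (reversed h) := hc.comp unitInterval.continuous_symm

theorem continuous_lower {h : unitInterval → ℝ} (hc : Continuous h) :
    Continuous (fun t => h t - 2 * lowerShift h t) :=
  hc.sub (continuous_const.mul (continuous_lowerShift hc))

theorem minValue_raise {h : unitInterval → ℝ} (hc : Continuous h)
    (h0 : 1 ≤ h 0 - minValue h) :
    minValue (fun t => h t + 2 * raiseShift h t) = minValue h + 1 := by
  have hr := continuous_reversed hc
  rw [raise_eq_reversed, minValue_reversed,
    minValue_add_const (continuous_lower hr),
    minValue_lower hr (by simpa [reversed, minValue_reversed] using h0), minValue_reversed]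
  ring

theorem lowerShift_raise {h : unitInterval → ℝ} (hc : Continuous h)
    (h0 : 1 ≤ h 0 - minValue h) (t : unitInterval) :
    lowerShift (fun t => h t + 2 * raiseShift h t) t = raiseShift h t := by
  have hr := continuous_reversed hc
  have h1 : 1 ≤ reversed h 1 - minValue (reversed h) := by
    simpa [reversed, minValue_reversed] using h0
  have hr' := continuous_lower hr
  rw [raise_eq_reversed, lowerShift_reversed, raiseShift, minValue_add_const hr',
    pastMin_add_const hr']
  have := raiseShift_lower hr h1 (unitInterval.symm t)
  rw [raiseShift, lowerShift_reversed, unitInterval.symm_symm] at this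
  rw [show ∀ a b : ℝ, 1 + (a + 2) - (b + 2) = 1 + a - b by intros; ring, this]
  ring

end Shift

/-! ### The path model of the highest weight crystals -/

section Powers

theorem partialPow_succ' {B : Type*} (g : B → Option B) (k : ℕ) (x : B) :
    partialPow g (k + 1) x = (g x).bind (partialPow g k) := by
  induction k with
  | zero => cases h : g x <;> simp [partialPow, h]
  | succ k ih =>
    rw [partialPow, ih, Option.bind_assoc]
    rfl

theorem partialPow_ne_none_iff {B : Type*} {g : B → Option B} {r : B → ℝ}
    (hn : ∀ x, g x ≠ none ↔ 1 ≤ r x) (hs : ∀ x y, g x = some y → r y = r x - 1)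
    (k : ℕ) (x : B) (hx : 0 ≤ r x) : partialPow g k x ≠ none ↔ (k : ℝ) ≤ r x := by
  induction k generalizing x with
  | zero => simpa [partialPow] using hx
  | succ k ih =>
    rw [partialPow_succ']
    cases h : g x with
    | none =>
      have h1 : ¬ 1 ≤ r x := fun h1 => (hn x).mpr h1 h
      have h2 : (0 : ℝ) ≤ k := k.cast_nonneg
      push_cast
      constructor
      · intro h3
        exact absurd rfl h3
      · intro h3
        exact absurd (by linarith) h1
    | some y =>
      have h1 : 1 ≤ r x := (hn x).mp (by simp [h])
      have h2 := hs x y h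
      rw [Option.bind_some, ih y (by linarith), h2]
      push_cast
      constructor <;> intro <;> linarith

theorem isGreatest_partialPow {B : Type*} {g : B → Option B} {r : B → ℝ}
    (hn : ∀ x, g x ≠ none ↔ 1 ≤ r x) (hs : ∀ x y, g x = some y → r y = r x - 1)
    (x : B) (hx : 0 ≤ r x) :
    IsGreatest {k : ℕ | partialPow g k x ≠ none} ⌊r x⌋₊ :=
  ⟨(partialPow_ne_none_iff hn hs _ x hx).mpr (Nat.floor_le hx),
    fun k hk => Nat.le_floor ((partialPow_ne_none_iff hn hs k x hx).mp hk)⟩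

end Powers

section Path

variable {ι M N : Type*} [AddCommGroup M] [Module ℝ M] [AddCommGroup N] [Module ℝ N]
  (P : RootPairing ι ℝ M N)

/-- The height function `t ↦ ⟨π(t), α_i^∨⟩` of a path `π`. -/
def pathHeight (i : ι) (p : unitInterval → M) (t : unitInterval) : ℝ := P.coroot' i (p t)

open Classical in
/-- Littelmann's raising operator on paths. With `m` the minimum of the height function `h`, it is
defined when `-m ≥ 1`; it reflects in `s_i` the parts of the path, between the last time before
which `h ≥ m + 1` and the first time at which `h = m`, where `h` attains a new minimum. -/
noncomputable def raisePath (i : ι) (p : unitInterval → M) : Option (unitInterval → M) :=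
  if 1 ≤ -minValue (pathHeight P i p) then
    some fun t => p t + raiseShift (pathHeight P i p) t • P.root i
  else none

open Classical in
/-- Littelmann's lowering operator on paths. With `m` the minimum of the height function `h`, it
is defined when `h(1) - m ≥ 1`; it reflects in `s_i` the parts of the path, between the last time
at which `h = m` and the first time after which `h ≥ m + 1`, where `h` equals its minimum over the
remaining time. -/
noncomputable def lowerPath (i : ι) (p : unitInterval → M) : Option (unitInterval → M) :=
  if 1 ≤ pathHeight P i p 1 - minValue (pathHeight P i p) then
    some fun t => p t - lowerShift (pathHeight P i p) t • P.root i
  else none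

variable {P}

/-- The paths obtained from the straight path `t ↦ t • x` by the operators `e_i` and `f_i`. -/
inductive InComponent (b : P.Base) (x : M) : (unitInterval → M) → Prop
  | straight : InComponent b x fun t => (t : ℝ) • x
  | raise (i : b.support) (p q : unitInterval → M) :
      InComponent b x p → raisePath P i p = some q → InComponent b x q
  | lower (i : b.support) (p q : unitInterval → M) :
      InComponent b x p → lowerPath P i p = some q → InComponent b x q

theorem pathHeight_raise (i j : ι) (p : unitInterval → M) (s : unitInterval → ℝ) :
    pathHeight P j (fun t => p t + s t • P.root i) =
      fun t => pathHeight P j p t + s t * P.pairing i j := by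
  funext t
  simp [pathHeight]

theorem pathHeight_lower (i j : ι) (p : unitInterval → M) (s : unitInterval → ℝ) :
    pathHeight P j (fun t => p t - s t • P.root i) =
      fun t => pathHeight P j p t - s t * P.pairing i j := by
  funext t
  simp [pathHeight]

theorem pathHeight_raise_self (i : ι) (p : unitInterval → M) (s : unitInterval → ℝ) :
    pathHeight P i (fun t => p t + s t • P.root i) =
      fun t => pathHeight P i p t + 2 * s t := by
  rw [pathHeight_raise, P.pairing_same]
  funext t
  ring

theorem pathHeight_lower_self (i : ι) (p : unitInterval → M) (s : unitInterval → ℝ) :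
    pathHeight P i (fun t => p t - s t • P.root i) =
      fun t => pathHeight P i p t - 2 * s t := by
  rw [pathHeight_lower, P.pairing_same]
  funext t
  ring

/-- The properties shared by all paths in the component of a straight path to a weight. -/
structure IsIntegralPath (P : RootPairing ι ℝ M N) (p : unitInterval → M) : Prop where
  zero : p 0 = 0
  one : p 1 ∈ weightLattice P
  continuous : ∀ j, Continuous (pathHeight P j p)

theorem IsIntegralPath.height_zero {p : unitInterval → M} (hp : IsIntegralPath P p) (i : ι) :
    pathHeight P i p 0 = 0 := by
  simp [pathHeight, hp.zero]

theorem root_mem_weightLattice [P.IsCrystallographic] (i : ι) : P.root i ∈ weightLattice P := by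
  intro j
  obtain ⟨z, hz⟩ := P.exists_value (S := ℤ) i j
  exact ⟨z, by rw [P.root_coroot'_eq_pairing, ← hz]; simp⟩

theorem raisePath_eq_some {i : ι} {p q : unitInterval → M} (h : raisePath P i p = some q) :
    1 ≤ -minValue (pathHeight P i p) ∧
      q = fun t => p t + raiseShift (pathHeight P i p) t • P.root i := by
  unfold raisePath at h
  split_ifs at h with h1
  exact ⟨h1, (Option.some.inj h).symm⟩

theorem lowerPath_eq_some {i : ι} {p q : unitInterval → M} (h : lowerPath P i p = some q) :
    1 ≤ pathHeight P i p 1 - minValue (pathHeight P i p) ∧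
      q = fun t => p t - lowerShift (pathHeight P i p) t • P.root i := by
  unfold lowerPath at h
  split_ifs at h with h1
  exact ⟨h1, (Option.some.inj h).symm⟩

theorem raisePath_one {i : ι} {p q : unitInterval → M} (hp : IsIntegralPath P p)
    (h : raisePath P i p = some q) : q 1 = p 1 + P.root i := by
  obtain ⟨-, rfl⟩ := raisePath_eq_some h
  simp [raiseShift_one (hp.continuous i)]

theorem lowerPath_one {i : ι} {p q : unitInterval → M}
    (h : lowerPath P i p = some q) : q 1 = p 1 - P.root i := by
  obtain ⟨h1, rfl⟩ := lowerPath_eq_some h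
  simp [lowerShift_one h1]

theorem IsIntegralPath.raise [P.IsCrystallographic] {i : ι} {p q : unitInterval → M}
    (hp : IsIntegralPath P p) (h : raisePath P i p = some q) : IsIntegralPath P q := by
  have h1 := raisePath_one hp h
  obtain ⟨h2, rfl⟩ := raisePath_eq_some h
  refine ⟨?_, ?_, fun j => ?_⟩
  · have h3 : raiseShift (pathHeight P i p) 0 = 0 :=
      raiseShift_zero (by rw [hp.height_zero]; linarith)
    simp [h3, hp.zero]
  · have h3 := add_mem hp.one (root_mem_weightLattice (P := P) i)
    rw [← h1] at h3
    exact h3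
  · rw [pathHeight_raise]
    exact (hp.continuous j).add ((continuous_raiseShift (hp.continuous i)).mul continuous_const)

theorem IsIntegralPath.lower [P.IsCrystallographic] {i : ι} {p q : unitInterval → M}
    (hp : IsIntegralPath P p) (h : lowerPath P i p = some q) : IsIntegralPath P q := by
  have h1 := lowerPath_one h
  obtain ⟨h2, rfl⟩ := lowerPath_eq_some h
  refine ⟨?_, ?_, fun j => ?_⟩
  · simp [lowerShift_zero (hp.continuous i), hp.zero]
  · have h3 := sub_mem hp.one (root_mem_weightLattice (P := P) i)
    rw [← h1] at h3
    exact h3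
  · rw [pathHeight_lower]
    exact (hp.continuous j).sub ((continuous_lowerShift (hp.continuous i)).mul continuous_const)

theorem InComponent.isIntegralPath [P.IsCrystallographic] {b : P.Base} {x : M}
    (hx : x ∈ weightLattice P) {p : unitInterval → M} (hp : InComponent b x p) :
    IsIntegralPath P p := by
  induction hp with
  | straight =>
    refine ⟨by simp, by simpa using hx, fun j => ?_⟩
    have : pathHeight P j (fun t : unitInterval => (t : ℝ) • x) =
        fun t : unitInterval => (t : ℝ) * P.coroot' j x := by
      funext t
      simp [pathHeight]
    rw [this]
    exact continuous_subtype_val.mul continuous_const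
  | raise i p q _ h ih => exact ih.raise h
  | lower i p q _ h ih => exact ih.lower h

theorem raise_of_lower {i : ι} {p q : unitInterval → M} (hp : IsIntegralPath P p)
    (h : lowerPath P i p = some q) : raisePath P i q = some p := by
  have hc := hp.continuous i
  obtain ⟨h1, rfl⟩ := lowerPath_eq_some h
  have h0 := minValue_le hc 0
  rw [hp.height_zero] at h0
  rw [raisePath, pathHeight_lower_self, minValue_lower hc h1, if_pos (by linarith)]
  congr 1
  funext t
  rw [raiseShift_lower hc h1, sub_add_cancel]

theorem lower_of_raise {i : ι} {p q : unitInterval → M} (hp : IsIntegralPath P p)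
    (h : raisePath P i p = some q) : lowerPath P i q = some p := by
  have hc := hp.continuous i
  obtain ⟨h1, rfl⟩ := raisePath_eq_some h
  have h0 : 1 ≤ pathHeight P i p 0 - minValue (pathHeight P i p) := by
    rw [hp.height_zero]; linarith
  have h2 := minValue_le hc 1
  rw [lowerPath, pathHeight_raise_self, minValue_raise hc h0,
    if_pos (by simp only [raiseShift_one hc]; linarith)]
  congr 1
  funext t
  rw [lowerShift_raise hc h0, add_sub_cancel_right]

theorem minValue_raisePath {i : ι} {p q : unitInterval → M} (hp : IsIntegralPath P p)
    (h : raisePath P i p = some q) :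
    minValue (pathHeight P i q) = minValue (pathHeight P i p) + 1 := by
  obtain ⟨h1, rfl⟩ := raisePath_eq_some h
  rw [pathHeight_raise_self, minValue_raise (hp.continuous i)]
  rw [hp.height_zero]
  linarith

theorem minValue_lowerPath {i : ι} {p q : unitInterval → M} (hp : IsIntegralPath P p)
    (h : lowerPath P i p = some q) :
    minValue (pathHeight P i q) = minValue (pathHeight P i p) - 1 := by
  obtain ⟨h1, rfl⟩ := lowerPath_eq_some h
  rw [pathHeight_lower_self, minValue_lower (hp.continuous i) h1]

theorem height_lowerPath {i : ι} {p q : unitInterval → M} (h : lowerPath P i p = some q) :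
    pathHeight P i q 1 = pathHeight P i p 1 - 2 := by
  simp [pathHeight, lowerPath_one h]

theorem raisePath_ne_none {i : ι} {p : unitInterval → M} :
    raisePath P i p ≠ none ↔ 1 ≤ -minValue (pathHeight P i p) := by
  unfold raisePath
  split_ifs with h <;> simp [h]

theorem lowerPath_ne_none {i : ι} {p : unitInterval → M} :
    lowerPath P i p ≠ none ↔ 1 ≤ pathHeight P i p 1 - minValue (pathHeight P i p) := by
  unfold lowerPath
  split_ifs with h <;> simp [h]

/-- Restriction of a partial map to an invariant subset. -/
def restrictPartial {B : Type*} {S : B → Prop} (g : B → Option B)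
    (H : ∀ p q, S p → g p = some q → S q) (x : {p // S p}) : Option {p // S p} :=
  match h : g x.1 with
  | none => none
  | some q => some ⟨q, H x.1 q x.2 h⟩

theorem restrictPartial_eq_some {B : Type*} {S : B → Prop} {g : B → Option B}
    {H : ∀ p q, S p → g p = some q → S q} {x y : {p // S p}} :
    restrictPartial g H x = some y ↔ g x.1 = some y.1 := by
  unfold restrictPartial
  split
  · rename_i h
    simp [h]
  · rename_i q h
    simp [h, Subtype.ext_iff]

theorem restrictPartial_ne_none {B : Type*} {S : B → Prop} {g : B → Option B}
    {H : ∀ p q, S p → g p = some q → S q} {x : {p // S p}} :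
    restrictPartial g H x ≠ none ↔ g x.1 ≠ none := by
  unfold restrictPartial
  split
  · rename_i h
    simp [h]
  · rename_i q h
    simp [h]

/-- The raising operators on the component of the straight path to `x`. -/
noncomputable def raiseOp (b : P.Base) (x : M) (i : b.support) :
    {p // InComponent b x p} → Option {p // InComponent b x p} :=
  restrictPartial (raisePath P i) fun p q => InComponent.raise i p q

/-- The lowering operators on the component of the straight path to `x`. -/
noncomputable def lowerOp (b : P.Base) (x : M) (i : b.support) :
    {p // InComponent b x p} → Option {p // InComponent b x p} :=
  restrictPartial (lowerPath P i) fun p q => InComponent.lower i p q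

theorem isGreatest_raise [P.IsCrystallographic] (b : P.Base) {x : M} (hx : x ∈ weightLattice P)
    (i : b.support) (p : {p // InComponent b x p}) :
    IsGreatest {k : ℕ | partialPow (raiseOp b x i) k p ≠ none}
      ⌊-minValue (pathHeight P i p.1)⌋₊ := by
  have hn : ∀ p, raiseOp b x i p ≠ none ↔ 1 ≤ -minValue (pathHeight P i p.1) :=
    fun p => restrictPartial_ne_none.trans raisePath_ne_none
  have hs : ∀ p q, raiseOp b x i p = some q →
      -minValue (pathHeight P i q.1) = -minValue (pathHeight P i p.1) - 1 := fun p q h => by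
    have := minValue_raisePath (p.2.isIntegralPath hx) (restrictPartial_eq_some.mp h)
    linarith
  refine isGreatest_partialPow (r := fun p : {p // InComponent b x p} =>
    -minValue (pathHeight P i p.1)) hn hs p ?_
  have hp := p.2.isIntegralPath hx
  have := minValue_le (hp.continuous i) 0
  rw [hp.height_zero] at this
  linarith

theorem isGreatest_lower [P.IsCrystallographic] (b : P.Base) {x : M} (hx : x ∈ weightLattice P)
    (i : b.support) (p : {p // InComponent b x p}) :
    IsGreatest {k : ℕ | partialPow (lowerOp b x i) k p ≠ none}
      ⌊pathHeight P i p.1 1 - minValue (pathHeight P i p.1)⌋₊ := by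
  have hn : ∀ p, lowerOp b x i p ≠ none ↔
      1 ≤ pathHeight P i p.1 1 - minValue (pathHeight P i p.1) :=
    fun p => restrictPartial_ne_none.trans lowerPath_ne_none
  have hs : ∀ p q, lowerOp b x i p = some q →
      pathHeight P i q.1 1 - minValue (pathHeight P i q.1) =
        pathHeight P i p.1 1 - minValue (pathHeight P i p.1) - 1 := fun p q h => by
    have h1 := minValue_lowerPath (p.2.isIntegralPath hx) (restrictPartial_eq_some.mp h)
    have h2 := height_lowerPath (restrictPartial_eq_some.mp h)
    linarith
  refine isGreatest_partialPow (r := fun p : {p // InComponent b x p} =>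
    pathHeight P i p.1 1 - minValue (pathHeight P i p.1)) hn hs p ?_
  have := minValue_le ((p.2.isIntegralPath hx).continuous i) 1
  linarith

/-- The highest weight crystal `B(x)` of a dominant weight `x`, in Littelmann's path model: the
set of all paths obtained from the straight path from `0` to `x` by the operators `e_i` and `f_i`,
the weight of a path being its endpoint. -/
noncomputable def highestWeightCrystal [P.IsCrystallographic] (b : P.Base)
    (x : weightLattice P) : Crystal b where
  carrier := {p : unitInterval → M // InComponent b (x : M) p}
  wt p := ⟨p.1 1, (p.2.isIntegralPath x.2).one⟩
  e i := raiseOp b x i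
  f i := lowerOp b x i
  ε i p := ⌊-minValue (pathHeight P i p.1)⌋₊
  φ i p := ⌊pathHeight P i p.1 1 - minValue (pathHeight P i p.1)⌋₊
  f_eq_some_iff i p q := by
    rw [raiseOp, lowerOp, restrictPartial_eq_some, restrictPartial_eq_some]
    exact ⟨raise_of_lower (p.2.isIntegralPath x.2), lower_of_raise (q.2.isIntegralPath x.2)⟩
  wt_of_f i p q h := lowerPath_one (restrictPartial_eq_some.mp h)
  isGreatest_ε i p := isGreatest_raise b x.2 i p
  isGreatest_φ i p := isGreatest_lower b x.2 i p
  φ_eq i p := by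
    have hp := p.2.isIntegralPath x.2
    obtain ⟨n, hn⟩ := hp.one i
    have h0 := minValue_le (hp.continuous i) 0
    have h1 := minValue_le (hp.continuous i) 1
    rw [hp.height_zero] at h0
    have hn' : pathHeight P i p.1 1 = n := hn
    have h2 : ((⌊pathHeight P i p.1 1 - minValue (pathHeight P i p.1)⌋₊ : ℤ)) =
        n + (⌊-minValue (pathHeight P i p.1)⌋₊ : ℤ) := by
      rw [Int.natCast_floor_eq_floor (by linarith), Int.natCast_floor_eq_floor (by linarith), hn',
        sub_eq_add_neg, Int.floor_intCast_add]
    change _ = P.coroot' i (p.1 1) + _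
    rw [hn]
    exact_mod_cast h2

end Path

end CrystalTheory

namespace CrystalTheory

/-! ### Increments of the shift functions of the root operators -/

section Shift

/-! The inclusion `ℰ(Z) ⊆ X` holds because an extremal set is stable under every nonzero `e_i`: if
`e_i x ≠ 0`, then `x ∈ X` is not the top of its `i`-string, so the whole string lies in `X`
(`IsExtremal.mem_of_e`). For `X ⊆ ℰ(Z)`, an `x ∈ X` that is not lowest has some `f_i x ∈ X`, and `x
= e_i (f_i x)`; so one descends inside `X` to a lowest weight element and reads the descent
backwards (`subset_raisingClosure`).

The substance is that this descent stops. Each step subtracts a simple root, so it suffices that the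
functional taking the value 1 on every simple root is bounded below on the weights. The bound comes
from the path model. Over any time interval, a root operator changes the increment of a path only by
applying `s_i` to the increment over a subinterval (`exists_lowerShift_sub_eq`,
`exists_raiseShift_sub_eq`). Since `s_i` permutes the coroots, a Lipschitz constant valid for the
pairings with all coroots at once is preserved (`HeightLipschitz.of_reflection`). The straight path
to `λ` has the constant `max_j |⟨λ, α_j^∨⟩|`, which therefore bounds all coroot pairings of the
endpoint of every path in the crystal. As the coroots span, every linear functional is bounded on
the weights. -/

theorem lowerShift_mono {h : unitInterval → ℝ} (hc : Continuous h) {s t : unitInterval}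
    (hst : s ≤ t) : lowerShift h s ≤ lowerShift h t :=
  min_le_min_left _ (sub_le_sub_right (futureMin_mono hc hst) _)

/-- The lowering shift varies on `[s, t]` only between two times `s'` and `t'`, and its variation
there is that of `h`. -/
theorem exists_lowerShift_sub_eq {h : unitInterval → ℝ} (hc : Continuous h) {s t : unitInterval}
    (hst : s ≤ t) :
    ∃ s' t', s ≤ s' ∧ s' ≤ t' ∧ t' ≤ t ∧ lowerShift h s' = lowerShift h s ∧
      lowerShift h t' = lowerShift h t ∧
      lowerShift h t' - lowerShift h s' = h t' - h s' := by
  rcases (lowerShift_mono hc hst).eq_or_lt with heq | hlt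
  · exact ⟨s, s, le_rfl, le_rfl, hst, rfl, heq, by simp⟩
  have hle (r : unitInterval) : lowerShift h r ≤ h r - minValue h :=
    (min_le_right _ _).trans (sub_le_sub_right (futureMin_le hc le_rfl) _)
  have hpos (r : unitInterval) : 0 ≤ lowerShift h r :=
    le_min zero_le_one (sub_nonneg.mpr (minValue_le_futureMin hc r))
  have ht : minValue h < futureMin h t := by
    have h1 : lowerShift h t ≤ futureMin h t - minValue h := min_le_right _ _
    linarith [hpos s]
  -- Here `h t' - m = 2 L(t') - L(t)`, with `m` the minimum and `L` the shift. As `L ≤ h - m` and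
  -- `L` is monotone, this forces `L(t') = L(t) = h t' - m`.
  obtain ⟨t', ht't, ht'⟩ := exists_lower hc ht
  have h1 := lowerShift_mono hc ht't
  have hLt : lowerShift h t' = lowerShift h t := by linarith [hle t']
  -- The truncation at 1 is inactive at `s`, because `L(s) < L(t) ≤ 1`.
  have hs : lowerShift h s = futureMin h s - minValue h := by
    have h2 : lowerShift h t ≤ 1 := min_le_left _ _
    rcases min_choice 1 (futureMin h s - minValue h) with h3 | h3
    · rw [← lowerShift] at h3
      linarith
    · exact h3
  -- Where the minimum over `[s, 1]` is attained, `h s' - m = L(s)`; with the same relation at `t'`,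
  -- the increments of `h` and `L` agree.
  obtain ⟨s', hss', hs'⟩ : ∃ s', s ≤ s' ∧ h s' = futureMin h s := by
    obtain ⟨r, hr, hmin⟩ := (isClosed_Ici (a := s)).isCompact.exists_isMinOn ⟨s, Set.self_mem_Ici⟩
      hc.continuousOn
    exact ⟨r, hr, le_antisymm (le_futureMin fun x hx => hmin hx) (futureMin_le hc hr)⟩
  have hLs : lowerShift h s' = lowerShift h s :=
    le_antisymm (by linarith [hle s']) (lowerShift_mono hc hss')
  have hst' : s' ≤ t' := by
    by_contra hcon
    linarith [lowerShift_mono hc (not_le.mp hcon).le]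
  exact ⟨s', t', hss', hst', ht't, hLs, hLt, by linarith⟩

/-- The raising shift varies on `[s, t]` only between two times `s'` and `t'`, and its variation
there is opposite to that of `h`. -/
theorem exists_raiseShift_sub_eq {h : unitInterval → ℝ} (hc : Continuous h) {s t : unitInterval}
    (hst : s ≤ t) :
    ∃ s' t', s ≤ s' ∧ s' ≤ t' ∧ t' ≤ t ∧ raiseShift h s' = raiseShift h s ∧
      raiseShift h t' = raiseShift h t ∧
      raiseShift h t' - raiseShift h s' = -(h t' - h s') := by
  -- Time reversal turns the raising shift into 1 minus a lowering shift, and exchanges the two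
  -- intermediate times.
  obtain ⟨x, y, h1, h2, h3, h4, h5, h6⟩ := exists_lowerShift_sub_eq (continuous_reversed hc)
    (unitInterval.symm_le_symm.mpr hst)
  simp only [lowerShift_reversed, unitInterval.symm_symm, reversed] at h4 h5 h6
  refine ⟨unitInterval.symm y, unitInterval.symm x, ?_, unitInterval.symm_le_symm.mpr h2, ?_,
    by linarith, by linarith, by linarith⟩
  · simpa using unitInterval.symm_le_symm.mpr h3
  · simpa using unitInterval.symm_le_symm.mpr h1

end Shift

/-! ### Boundedness of the weights of a highest weight crystal -/

section Path

variable {ι M N : Type*} [AddCommGroup M] [Module ℝ M] [AddCommGroup N] [Module ℝ N]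
  {P : RootPairing ι ℝ M N}

/-- All the height functions of the path `p` are Lipschitz with constant `C`. -/
def HeightLipschitz (P : RootPairing ι ℝ M N) (C : ℝ) (p : unitInterval → M) : Prop :=
  ∀ s t : unitInterval, s ≤ t → ∀ j, |P.coroot' j (p t - p s)| ≤ C * ((t : ℝ) - s)

/-- Reflecting a middle piece of each piece of a path preserves the Lipschitz constant of its
height functions. -/
theorem HeightLipschitz.of_reflection {C : ℝ} {p q : unitInterval → M}
    (hp : HeightLipschitz P C p) (i : ι)
    (H : ∀ s t : unitInterval, s ≤ t → ∃ s' t', s ≤ s' ∧ s' ≤ t' ∧ t' ≤ t ∧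
      q s' - q s = p s' - p s ∧ q t - q t' = p t - p t' ∧
      q t' - q s' = P.reflection i (p t' - p s')) : HeightLipschitz P C q := by
  intro s t hst j
  obtain ⟨s', t', h1, h2, h3, h4, h5, h6⟩ := H s t hst
  have h7 : q t - q s = (q s' - q s) + (q t' - q s') + (q t - q t') := by abel
  rw [h7, h4, h5, h6, map_add, map_add, P.coroot'_reflection]
  have a1 := hp s s' h1 j
  -- The reflection is moved from the vector to the coroot, which becomes another coroot; this is
  -- why the Lipschitz bound is required for all coroots simultaneously.
  have a2 := hp s' t' h2 (P.reflectionPerm i j)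
  have a3 := hp t' t h3 j
  refine (abs_add_three _ _ _).trans ?_
  linarith

/-- The shift has equal values at the two ends of each outer piece, so the increments there are
unchanged; across the middle piece it grows by exactly the increment of the height, which is what
`s_i` subtracts. -/
theorem HeightLipschitz.lower {C : ℝ} {i : ι} {p q : unitInterval → M}
    (hp : HeightLipschitz P C p) (hc : Continuous (pathHeight P i p))
    (h : lowerPath P i p = some q) : HeightLipschitz P C q := by
  obtain ⟨-, rfl⟩ := lowerPath_eq_some h
  refine hp.of_reflection i fun s t hst => ?_
  obtain ⟨s', t', h1, h2, h3, h4, h5, h6⟩ := exists_lowerShift_sub_eq hc hst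
  refine ⟨s', t', h1, h2, h3, by simp only [h4]; abel, by simp only [h5]; abel, ?_⟩
  rw [P.reflection_apply, map_sub]
  change _ = _ - (pathHeight P i p t' - pathHeight P i p s') • P.root i
  rw [← h6]
  module

theorem HeightLipschitz.raise {C : ℝ} {i : ι} {p q : unitInterval → M}
    (hp : HeightLipschitz P C p) (hc : Continuous (pathHeight P i p))
    (h : raisePath P i p = some q) : HeightLipschitz P C q := by
  obtain ⟨-, rfl⟩ := raisePath_eq_some h
  refine hp.of_reflection i fun s t hst => ?_
  obtain ⟨s', t', h1, h2, h3, h4, h5, h6⟩ := exists_raiseShift_sub_eq hc hst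
  refine ⟨s', t', h1, h2, h3, by simp only [h4]; abel, by simp only [h5]; abel, ?_⟩
  rw [P.reflection_apply, map_sub]
  change _ = _ - (pathHeight P i p t' - pathHeight P i p s') • P.root i
  rw [← neg_eq_iff_eq_neg.mpr h6]
  module

/-- The straight path has increments `(t - s) • x`, and both root operators preserve the constant.
-/
theorem InComponent.heightLipschitz [P.IsCrystallographic] {b : P.Base} {x : M}
    (hx : x ∈ weightLattice P) {C : ℝ} (hC : ∀ j, |P.coroot' j x| ≤ C)
    {p : unitInterval → M} (hp : InComponent b x p) : HeightLipschitz P C p := by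
  induction hp with
  | straight =>
    intro s t hst j
    have h0 : 0 ≤ (t : ℝ) - s := sub_nonneg.mpr hst
    rw [← sub_smul, map_smul, smul_eq_mul, abs_mul, abs_of_nonneg h0, mul_comm]
    exact mul_le_mul_of_nonneg_right (hC j) h0
  | raise i p q hp h ih => exact ih.raise ((hp.isIntegralPath hx).continuous i) h
  | lower i p q hp h ih => exact ih.lower ((hp.isIntegralPath hx).continuous i) h

/-- The weights of a highest weight crystal pair boundedly with all coroots. -/
theorem exists_abs_coroot_wt_le [Finite ι] [P.IsCrystallographic] (b : P.Base)
    (x : weightLattice P) :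
    ∃ C, ∀ (p : (highestWeightCrystal b x).carrier) (j : ι),
      |P.coroot' j ((highestWeightCrystal b x).wt p : M)| ≤ C := by
  obtain ⟨C, hC⟩ := (Set.finite_range fun j => |P.coroot' j (x : M)|).bddAbove
  refine ⟨C, fun p j => ?_⟩
  -- The weight is the increment of the path over all of `[0, 1]`, an interval of length 1.
  have h1 := p.2.heightLipschitz x.2 (fun j => hC ⟨j, rfl⟩) 0 1 (unitInterval.le_one 0) j
  rw [(p.2.isIntegralPath x.2).zero] at h1
  change |P.coroot' j (p.1 1)| ≤ C
  simpa using h1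

/-- A linear functional is bounded on the vectors that pair boundedly with all coroots. -/
theorem exists_abs_le_of_abs_coroot_le [P.IsRootSystem] (g : M →ₗ[ℝ] ℝ) (C : ℝ) :
    ∃ K, ∀ x, (∀ j, |P.coroot' j x| ≤ C) → |g x| ≤ K := by
  -- By perfectness of the pairing, `g` is pairing with a vector `n`, which is a linear combination
  -- of coroots; the bound is built along that combination.
  obtain ⟨n, rfl⟩ : ∃ n, P.toLinearMap.flip n = g :=
    ⟨P.flip.toPerfPair.symm g, P.flip.toPerfPair.apply_symm_apply g⟩
  have hn : n ∈ Submodule.span ℝ (Set.range P.coroot) := by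
    rw [RootPairing.IsRootSystem.span_coroot_eq_top]
    trivial
  induction hn using Submodule.span_induction with
  | mem n hn =>
    obtain ⟨j, rfl⟩ := hn
    exact ⟨C, fun x hx => hx j⟩
  | zero => exact ⟨0, by simp⟩
  | add n k _ _ ihn ihk =>
    obtain ⟨K, hK⟩ := ihn
    obtain ⟨L, hL⟩ := ihk
    refine ⟨K + L, fun x hx => ?_⟩
    rw [map_add]
    exact (abs_add_le _ _).trans (add_le_add (hK x hx) (hL x hx))
  | smul c n _ ih =>
    obtain ⟨K, hK⟩ := ih
    refine ⟨|c| * K, fun x hx => ?_⟩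
    rw [map_smul, LinearMap.smul_apply, smul_eq_mul, abs_mul]
    exact mul_le_mul_of_nonneg_left (hK x hx) (abs_nonneg c)

end Path

/-! ### Extremal subsets and descent to lowest weight elements -/

namespace Crystal

variable {ι M N : Type*} [AddCommGroup M] [Module ℝ M] [AddCommGroup N] [Module ℝ N]
  {P : RootPairing ι ℝ M N} {b : P.Base} {C : Crystal b}

/-- Since `e_i x ≠ 0`, the element `x` is not the top of its string, which leaves only the
alternative that the whole string lies in `X`. -/
theorem IsExtremal.mem_of_e {X : Set C.carrier} (hX : C.IsExtremal X) {i : b.support}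
    {x y : C.carrier} (hx : x ∈ X) (h : C.e i x = some y) : y ∈ X := by
  have hxx : x ∈ C.string i x ∩ X := ⟨Or.inl ⟨0, rfl⟩, hx⟩
  have hy : y ∈ C.string i x := Or.inl ⟨1, by simpa [partialPow] using h⟩
  rcases hX i x with h1 | ⟨u, hu, h1⟩ | h1
  · rw [h1] at hxx
    exact hxx.elim
  · rw [h1, Set.mem_singleton_iff] at hxx
    rw [← hxx] at hu
    rw [hu.2] at h
    cases h
  · rw [← h1] at hy
    exact hy.2

theorem IsExtremal.mem_of_partialPow {X : Set C.carrier} (hX : C.IsExtremal X) {i : b.support}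
    {d : ℕ} {x y : C.carrier} (hx : x ∈ X) (h : partialPow (C.e i) d x = some y) : y ∈ X := by
  induction d generalizing y with
  | zero => exact Option.some.inj h ▸ hx
  | succ d ih =>
    obtain ⟨z, hz, hzy⟩ := Option.bind_eq_some_iff.mp h
    exact hX.mem_of_e (ih hz) hzy

theorem IsExtremal.mem_of_raise {X : Set C.carrier} (hX : C.IsExtremal X)
    (w : List (b.support × ℕ)) {x y : C.carrier} (hx : x ∈ X) (h : C.raise w x = some y) :
    y ∈ X := by
  induction w generalizing x with
  | nil => exact Option.some.inj h ▸ hx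
  | cons a w ih =>
    obtain ⟨z, hz, hzy⟩ := Option.bind_eq_some_iff.mp h
    exact ih (hX.mem_of_partialPow hx hz) hzy

/-- Words act from their first letter on, so a further raising step goes at the end of the word;
this makes `raisingClosure` stable under `e_i`. -/
theorem raise_append_singleton (w : List (b.support × ℕ)) (i : b.support) (d : ℕ)
    (x : C.carrier) : C.raise (w ++ [(i, d)]) x = (C.raise w x).bind (partialPow (C.e i) d) := by
  induction w generalizing x with
  | nil =>
    exact Option.bind_fun_some _
  | cons a w ih =>
    change (partialPow (C.e a.1) a.2 x).bind (C.raise (w ++ [(i, d)])) =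
      ((partialPow (C.e a.1) a.2 x).bind (C.raise w)).bind _
    rw [Option.bind_assoc]
    exact congrArg _ (funext ih)

theorem mem_raisingClosure_of_e {Z : Set C.carrier} {i : b.support} {x y : C.carrier}
    (hx : x ∈ C.raisingClosure Z) (h : C.e i x = some y) : y ∈ C.raisingClosure Z := by
  obtain ⟨z, hz, w, hw⟩ := hx
  refine ⟨z, hz, w ++ [(i, 1)], ?_⟩
  rw [raise_append_singleton, hw]
  simpa [partialPow] using h

/-- If some linear functional on the weights takes the value `1` on simple roots and is bounded
below, every element of `X` is obtained by raising a lowest weight element of `X`. -/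
theorem subset_raisingClosure (X : Set C.carrier) (g : M →ₗ[ℝ] ℝ)
    (hg : ∀ i : b.support, g (P.root i) = 1) {K : ℝ} (hK : ∀ x, K ≤ g (C.wt x : M)) :
    X ⊆ C.raisingClosure (C.lowestWeightElements X) := by
  -- Induction on how far `g` of the weight lies above its lower bound: each lowering step decreases
  -- `g` by 1. The strict inequality makes the case `n = 0` vacuous.
  suffices H : ∀ (n : ℕ) (x : C.carrier), g (C.wt x : M) < K + n → x ∈ X →
      x ∈ C.raisingClosure (C.lowestWeightElements X) by
    intro x hx
    obtain ⟨n, hn⟩ := exists_nat_gt (g (C.wt x : M) - K)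
    exact H n x (by linarith) hx
  intro n
  induction n with
  | zero =>
    intro x h
    have := hK x
    simp only [Nat.cast_zero, add_zero] at h
    linarith
  | succ n ih =>
    intro x h hx
    by_cases hl : x ∈ C.lowestWeightElements X
    · exact ⟨x, hl, [], rfl⟩
    · obtain ⟨i, y, hy, hyX⟩ : ∃ i y, C.f i x = some y ∧ y ∈ X := by
        by_contra! hcon
        refine hl ⟨hx, fun i => ?_⟩
        cases hf : C.f i x with
        | none => exact Or.inl rfl
        | some y => exact Or.inr ⟨y, rfl, hcon i y hf⟩
      -- From `f_i x = y` one recovers `x = e_i y`, so `x` inherits membership from the lower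
      -- element `y`.
      refine mem_raisingClosure_of_e (ih y ?_ hyX) ((C.f_eq_some_iff i x y).mp hy)
      rw [C.wt_of_f i x y hy, map_sub, hg]
      push_cast at h
      linarith

end Crystal

end CrystalTheory

/-! ### The proposition -/

theorem mainTheorem7 {ι M N : Type*} [Finite ι] [AddCommGroup M] [Module ℝ M]
    [AddCommGroup N] [Module ℝ N] (P : RootPairing ι ℝ M N) [P.IsRootSystem]
    [P.IsCrystallographic] [P.IsReduced] (b : P.Base)
    (lam : CrystalTheory.weightLattice P) (hlam : CrystalTheory.IsDominant b (lam : M))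
    (B : CrystalTheory.Crystal b)
    (hB : Nonempty (B.Iso (CrystalTheory.highestWeightCrystal b lam)))
    (X : Set B.carrier) (hX : B.IsExtremal X) :
    X = B.raisingClosure (B.lowestWeightElements X) := by
  obtain ⟨F⟩ := hB
  obtain ⟨C, hC⟩ := CrystalTheory.exists_abs_coroot_wt_le b lam
  -- The height functional: the simple roots form a basis of `M`, so a linear form can be prescribed
  -- to be 1 on each of them.
  let g : M →ₗ[ℝ] ℝ := b.toWeightBasis.constr ℝ fun _ => (1 : ℝ)
  obtain ⟨K, hK⟩ := CrystalTheory.exists_abs_le_of_abs_coroot_le (P := P) g C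
  refine Set.Subset.antisymm (CrystalTheory.Crystal.subset_raisingClosure X g (fun i => ?_)
    (K := -K) fun x => ?_) ?_
  · rw [← b.toWeightBasis_apply, Module.Basis.constr_basis]
  · refine (abs_le.mp (hK _ fun j => ?_)).1
    -- The isomorphism preserves weights, so the bound proved in the path model applies to `B`.
    rw [← F.wt_apply]
    exact hC _ j
  · rintro y ⟨z, hz, w, hw⟩
    exact hX.mem_of_raise w hz.1 hw
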